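/- Let $R$ be a commutative ring with unity. Call $R$ \emph{arithmetic} if, for every maximal ideal $P$ of $R$, the ideals of the localization $R_P$ are totally ordered by inclusion. A short exact sequence of $R$-modules $0\to N\to M\to L\to 0$ is \emph{pure-exact} if it remains exact after tensoring with any $R$-module, and \emph{RD-exact} if $rM\cap N=rN$ for every $r\in R$ (identifying $N$ with its image in $M$). An $R$-module $F$ is \emph{pure-injective} (respectively \emph{RD-injective}) if for every pure-exact (respectively RD-exact) sequence $0\to N\to M\to L\to 0$ of $R$-modules the sequence $0\to\operatorname{Hom}_R(L,F)\to\operatorname{Hom}_R(M,F)\to\operatorname{Hom}_R(N,F)\to 0$ is exact. Then the following assertions are equivalent: \begin{enumerate} \item $R$ is an arithmetic ring. \item Every RD-exact sequence of $R$-modules is pure-exact. \item Every pure-injective $R$-module is RD-injective. \end{enumerate} -/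

import Mathlib

open scoped Pointwise

universe u

/-- A module is uniserial if its submodules are totally ordered by inclusion. -/
def IsUniserialModule (R M : Type*) [CommRing R] [AddCommGroup M] [Module R M] : Prop :=
  ∀ A B : Submodule R M, A ≤ B ∨ B ≤ A

/-- A valuation ring (possibly with zero divisors): uniserial as a module over itself. -/
def IsUniserialRing (R : Type*) [CommRing R] : Prop :=
  IsUniserialModule R R

/-- `R` is arithmetic if its localization at every maximal ideal is a valuation ring. -/
def IsArithmeticRing (R : Type*) [CommRing R] : Prop :=
  ∀ (P : Ideal R) [P.IsMaximal], IsUniserialRing (Localization.AtPrime P)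

section Sequences

variable {R : Type*} [CommRing R] {N M L : Type*}
  [AddCommGroup N] [Module R N] [AddCommGroup M] [Module R M] [AddCommGroup L] [Module R L]

/-- The sequence `0 → N → M → L → 0` with maps `f` and `g` is exact. -/
structure IsShortExactSeq (f : N →ₗ[R] M) (g : M →ₗ[R] L) : Prop where
  injective : Function.Injective f
  exact : Function.Exact f g
  surjective : Function.Surjective g

/-- The short exact sequence `0 → N → M → L → 0` is RD-exact: `rM ∩ N = rN` for every `r`,
where `N` is identified with its image in `M`. -/
structure IsRDExact (f : N →ₗ[R] M) (g : M →ₗ[R] L) : Prop where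
  shortExact : IsShortExactSeq f g
  smul_inf : ∀ r : R, (r • (⊤ : Submodule R M)) ⊓ LinearMap.range f = r • LinearMap.range f

end Sequences

/-- The short exact sequence `0 → N → M → L → 0` is pure-exact: it remains exact after
tensoring with any `R`-module. -/
structure IsPureExact {R : Type u} [CommRing R] {N M L : Type u}
    [AddCommGroup N] [Module R N] [AddCommGroup M] [Module R M] [AddCommGroup L] [Module R L]
    (f : N →ₗ[R] M) (g : M →ₗ[R] L) : Prop where
  shortExact : IsShortExactSeq f g
  tensor : ∀ (X : Type u) [AddCommGroup X] [Module R X],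
    IsShortExactSeq (LinearMap.lTensor X f) (LinearMap.lTensor X g)

/-- `F` is pure-injective: `Hom(-, F)` keeps every pure-exact sequence exact. -/
def IsPureInjective (R : Type u) [CommRing R] (F : Type u) [AddCommGroup F] [Module R F] : Prop :=
  ∀ (N M L : Type u) [AddCommGroup N] [Module R N] [AddCommGroup M] [Module R M]
    [AddCommGroup L] [Module R L] (f : N →ₗ[R] M) (g : M →ₗ[R] L),
    IsPureExact f g → IsShortExactSeq (LinearMap.lcomp R F g) (LinearMap.lcomp R F f)

/-- `F` is RD-injective: `Hom(-, F)` keeps every RD-exact sequence exact. -/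
def IsRDInjective (R : Type u) [CommRing R] (F : Type u) [AddCommGroup F] [Module R F] : Prop :=
  ∀ (N M L : Type u) [AddCommGroup N] [Module R N] [AddCommGroup M] [Module R M]
    [AddCommGroup L] [Module R L] (f : N →ₗ[R] M) (g : M →ₗ[R] L),
    IsRDExact f g → IsShortExactSeq (LinearMap.lcomp R F g) (LinearMap.lcomp R F f)

/-!
That RD-exact sequences are pure-exact is a local property of the ring: RD-exactness is inherited by
localizations, injectivity of a map of tensor products can be checked at the maximal ideals, and
modules over a localization are also modules over `R`, with the same tensor products. So it is
enough to treat a local ring.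

For a short exact sequence `0 → N → M → L → 0`, tensoring keeps `N → M` injective as soon as every
finite linear system with right-hand side in `N` that is solvable in `M` is solvable in `N`. If the
sequence is RD-exact and divisibility in the ring is total, such a system can be solved by Gaussian
elimination, with a coefficient that divides all the others as pivot.

Conversely, let `a` and `b` be elements of a local ring, neither of which divides the other, and let
`X` be the module generated by `e₁` and `e₂` with the relation `a e₁ + b e₂ = 0`. There is an
RD-exact sequence ending in a map from a direct sum of modules `R ⧸ (r)` onto `X`. If it were
pure-exact, `e₁` and `e₂` would lift to a solution of `a x + b y = 0` in this sum; but such an `x`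
is always mapped into the submodule of `X` on which the first coordinate vanishes modulo the
maximal ideal.

Pure-injective modules enter through character modules: tensoring `N → M` with `X` gives an
injective map if and only if every map from `N` to the character module of `X` extends to `M`, so
character modules are pure-injective and there are enough of them to detect pure-exactness.
-/

open TensorProduct

theorem isUniserialRing_iff_dvd_total {R : Type*} [CommRing R] :
    IsUniserialRing R ↔ ∀ a b : R, a ∣ b ∨ b ∣ a :=
  calc
    IsUniserialRing R ↔ Std.Total (α := Ideal R) (· ≤ ·) := ⟨fun h => ⟨h⟩, fun h => h.total⟩
    _ ↔ Std.Total (α := R) (· ∣ ·) :=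
      PreValuationRing.iff_ideal_total.symm.trans PreValuationRing.iff_dvd_total
    _ ↔ ∀ a b : R, a ∣ b ∨ b ∣ a := ⟨fun h => h.total, fun h => ⟨h⟩⟩

theorem IsUniserialRing.exists_forall_dvd {R ι : Type*} [CommRing R] (hR : IsUniserialRing R)
    [Finite ι] [Nonempty ι] (a : ι → R) : ∃ i, ∀ j, a i ∣ a j := by
  have hdir : Directed (fun x y => y ∣ x) a := fun i j =>
    (isUniserialRing_iff_dvd_total.mp hR (a i) (a j)).elim (fun h => ⟨i, dvd_rfl, h⟩)
      (fun h => ⟨j, h, dvd_rfl⟩)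
  have : IsTrans R (fun x y => y ∣ x) := ⟨fun _ _ _ hxy hyz => hyz.trans hxy⟩
  exact hdir.finite_le id

section ExactSequences

variable {R : Type*} [CommRing R] {N M L : Type*}
  [AddCommGroup N] [Module R N] [AddCommGroup M] [Module R M] [AddCommGroup L] [Module R L]
  {f : N →ₗ[R] M} {g : M →ₗ[R] L}

theorem IsShortExactSeq.lcomp (h : IsShortExactSeq f g) {F : Type*} [AddCommGroup F] [Module R F]
    (hF : Function.Surjective (f.lcomp R F)) : IsShortExactSeq (g.lcomp R F) (f.lcomp R F) :=
  ⟨LinearMap.lcomp_injective_of_surjective g h.surjective,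
    LinearMap.exact_lcomp_of_exact_of_surjective F h.exact h.surjective, hF⟩

theorem isRDExact_iff_exists_smul_eq (h : IsShortExactSeq f g) :
    IsRDExact f g ↔ ∀ (r : R) (m : M) (n : N), r • m = f n → ∃ n', r • n' = n := by
  have mem_inf {r : R} {x : M} : x ∈ (r • (⊤ : Submodule R M)) ⊓ LinearMap.range f ↔
      ∃ m n, r • m = x ∧ f n = x := by
    simp [Submodule.mem_smul_pointwise_iff_exists]
  have mem_smul {r : R} {x : M} : x ∈ r • LinearMap.range f ↔ ∃ n, f (r • n) = x := by
    simp [Submodule.mem_smul_pointwise_iff_exists]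
  constructor
  · intro hRD r m n hmn
    obtain ⟨n', hn'⟩ := mem_smul.mp (hRD.smul_inf r ▸ mem_inf.mpr ⟨m, n, hmn, rfl⟩)
    exact ⟨n', h.injective hn'⟩
  · refine fun hdiv => ⟨h, fun r => Submodule.ext fun x => ?_⟩
    rw [mem_inf, mem_smul]
    constructor
    · rintro ⟨m, n, hm, rfl⟩
      obtain ⟨n', rfl⟩ := hdiv r m n hm
      exact ⟨n', rfl⟩
    · rintro ⟨n, rfl⟩
      exact ⟨f n, r • n, (map_smul f r n).symm, rfl⟩

theorem IsRDExact.exists_smul_eq (h : IsRDExact f g) {r : R} {m : M} {n : N} (hmn : r • m = f n) :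
    ∃ n', r • n' = n :=
  (isRDExact_iff_exists_smul_eq h.shortExact).mp h r m n hmn

theorem IsShortExactSeq.isRDExact_of_exists_lift (h : IsShortExactSeq f g)
    (hlift : ∀ (r : R) (x : L), r • x = 0 → ∃ m, r • m = 0 ∧ g m = x) : IsRDExact f g := by
  refine (isRDExact_iff_exists_smul_eq h).mpr fun r m n hmn => ?_
  have hgm : r • g m = 0 := by rw [← map_smul, hmn, h.exact.apply_apply_eq_zero]
  obtain ⟨m₀, hrm₀, hgm₀⟩ := hlift r (g m) hgm
  obtain ⟨n', hn'⟩ := (h.exact (m - m₀)).mp (by rw [map_sub, hgm₀, sub_self])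
  exact ⟨n', h.injective (by rw [map_smul, hn', smul_sub, hrm₀, sub_zero, hmn])⟩

/- Gaussian elimination: in a uniserial ring some coefficient `a p q` divides all the others, and
RD-exactness is used only to divide the `p`-th equation by this pivot. -/
theorem IsRDExact.exists_sum_smul_eq (hR : IsUniserialRing R) (h : IsRDExact f g) {ι : Type*}
    [Finite ι] {k : ℕ} (a : ι → Fin k → R) (n : ι → N) (y : Fin k → M)
    (hy : ∀ i, ∑ j, a i j • y j = f (n i)) : ∃ z : Fin k → N, ∀ i, ∑ j, a i j • z j = n i := by
  induction k generalizing n with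
  | zero => exact ⟨0, fun i => h.shortExact.injective (by simp [← hy i])⟩
  | succ k ih =>
    cases isEmpty_or_nonempty ι
    · exact ⟨0, isEmptyElim⟩
    obtain ⟨⟨p, q⟩, hpq⟩ := hR.exists_forall_dvd fun x : ι × Fin (k + 1) => a x.1 x.2
    choose b hb using fun j => hpq (p, q.succAbove j)
    choose c hc using fun i => hpq (i, q)
    dsimp only at hb hc
    simp only [Fin.sum_univ_succAbove _ q] at hy ⊢
    have hyp : a p q • (y q + ∑ j, b j • y (q.succAbove j)) = f (n p) := by
      simp only [← hy p, smul_add, Finset.smul_sum, smul_smul, hb]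
    obtain ⟨w, hw⟩ := h.exists_smul_eq hyp
    have hreduced (i : ι) : ∑ j, (a i (q.succAbove j) - a i q * b j) • y (q.succAbove j) =
        f (n i - c i • n p) := by
      simp only [map_sub, map_smul, ← hy i, ← hyp, sub_smul, Finset.sum_sub_distrib, mul_smul,
        ← Finset.smul_sum, smul_add, smul_smul (c i), mul_comm (c i), ← hc]
      abel
    obtain ⟨z, hz⟩ := ih _ _ _ hreduced
    refine ⟨q.insertNth (w - ∑ j, b j • z j) z, fun i => ?_⟩
    have hzi := hz i
    simp only [sub_smul, Finset.sum_sub_distrib, mul_smul, ← Finset.smul_sum, ← hw,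
      smul_smul (c i), mul_comm (c i), ← hc] at hzi
    simp only [Fin.insertNth_apply_same, Fin.insertNth_apply_succAbove, smul_sub]
    rw [sub_eq_sub_iff_add_eq_add] at hzi
    rw [sub_add_eq_add_sub, sub_eq_iff_eq_add, add_comm, hzi]

end ExactSequences

section Tensor

variable {R : Type*} [CommRing R] {N M : Type*} [AddCommGroup N] [Module R N] [AddCommGroup M]
  [Module R M] {f : N →ₗ[R] M}

theorem exists_sum_tmul_eq_of_span_eq_top {ι X : Type*} [Fintype ι] [AddCommGroup X] [Module R X]
    {x : ι → X} (hx : Submodule.span R (Set.range x) = ⊤) (t : X ⊗[R] N) :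
    ∃ n : ι → N, ∑ i, x i ⊗ₜ[R] n i = t := by
  induction t with
  | zero => exact ⟨0, by simp⟩
  | tmul y n =>
    obtain ⟨c, rfl⟩ := (Submodule.mem_span_range_iff_exists_fun R).mp
      (hx ▸ Submodule.mem_top : y ∈ Submodule.span R (Set.range x))
    exact ⟨fun i => c i • n, by simp [sum_tmul, smul_tmul]⟩
  | add t₁ t₂ h₁ h₂ =>
    obtain ⟨n₁, rfl⟩ := h₁
    obtain ⟨n₂, rfl⟩ := h₂
    exact ⟨n₁ + n₂, by simp [tmul_add, Finset.sum_add_distrib]⟩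

theorem lTensor_injective_of_forall_fg {X : Type*} [AddCommGroup X] [Module R X]
    (h : ∀ Q : Submodule R X, Q.FG → Function.Injective (f.lTensor Q)) :
    Function.Injective (f.lTensor X) := by
  refine (injective_iff_map_eq_zero _).mpr fun t ht => ?_
  obtain ⟨Q₀, hQ₀, hsub⟩ :=
    exists_finite_submodule_left_of_setFinite {t} (Set.finite_singleton t)
  obtain ⟨t₀, rfl⟩ := hsub rfl
  rw [← LinearMap.comp_apply, LinearMap.lTensor_comp_rTensor, ← LinearMap.rTensor_comp_lTensor,
    LinearMap.comp_apply] at ht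
  obtain ⟨Q, hle, hQ, h0⟩ := eq_zero_of_fg_of_subtype_eq_zero (Module.Finite.iff_fg.mp hQ₀) ht
  rw [← LinearMap.comp_apply, LinearMap.rTensor_comp_lTensor, ← LinearMap.lTensor_comp_rTensor,
    LinearMap.comp_apply, map_eq_zero_iff _ (h Q hQ)] at h0
  rw [← Submodule.subtype_comp_inclusion Q₀ Q hle, LinearMap.rTensor_comp, LinearMap.comp_apply,
    h0, map_zero]

theorem IsRDExact.lTensor_injective {L : Type*} [AddCommGroup L] [Module R L] {g : M →ₗ[R] L}
    (hR : IsUniserialRing R) (h : IsRDExact f g) (X : Type*) [AddCommGroup X] [Module R X] :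
    Function.Injective (f.lTensor X) := by
  refine lTensor_injective_of_forall_fg fun Q hQ => (injective_iff_map_eq_zero _).mpr fun t ht => ?_
  have := Module.Finite.iff_fg.mpr hQ
  obtain ⟨k, x, hx⟩ := Module.Finite.exists_fin (R := R) (M := Q)
  obtain ⟨n, rfl⟩ := exists_sum_tmul_eq_of_span_eq_top hx t
  simp only [map_sum, LinearMap.lTensor_tmul] at ht
  obtain ⟨l, a, y, hy, ha⟩ := vanishesTrivially_of_sum_tmul_eq_zero R hx ht
  obtain ⟨z, hz⟩ := h.exists_sum_smul_eq hR a n y fun i => (hy i).symm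
  exact sum_tmul_eq_zero_of_vanishesTrivially R ⟨l, a, z, fun i => (hz i).symm, ha⟩

theorem lTensor_injective_iff_lcomp_characterModule_surjective {X : Type*} [AddCommGroup X]
    [Module R X] :
    Function.Injective (f.lTensor X) ↔ Function.Surjective (f.lcomp R (CharacterModule X)) := by
  rw [← rTensor_injective_iff_lcomp_surjective, LinearMap.lTensor_inj_iff_rTensor_inj]

end Tensor

theorem exists_sum_smul_eq_of_mem_span_smul_top {R N ι : Type*} [CommRing R] [AddCommGroup N]
    [Module R N] [Fintype ι] {a : ι → R} {n : N}
    (hn : n ∈ Ideal.span (Set.range a) • (⊤ : Submodule R N)) :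
    ∃ z : ι → N, ∑ i, a i • z i = n := by
  induction hn using Submodule.smul_induction_on' with
  | smul r hr n _ =>
    obtain ⟨c, rfl⟩ := Ideal.mem_span_range_iff_exists_fun.mp hr
    exact ⟨fun i => c i • n, by simp only [Finset.sum_smul, mul_smul, smul_comm (c _)]⟩
  | add n₁ _ n₂ _ h₁ h₂ =>
    obtain ⟨z₁, rfl⟩ := h₁
    obtain ⟨z₂, rfl⟩ := h₂
    exact ⟨z₁ + z₂, by simp [Finset.sum_add_distrib]⟩

section PureExact

variable {R : Type u} [CommRing R] {N M L : Type u}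
  [AddCommGroup N] [Module R N] [AddCommGroup M] [Module R M] [AddCommGroup L] [Module R L]
  {f : N →ₗ[R] M} {g : M →ₗ[R] L}

theorem IsShortExactSeq.isPureExact (h : IsShortExactSeq f g)
    (hf : ∀ (X : Type u) [AddCommGroup X] [Module R X], Function.Injective (f.lTensor X)) :
    IsPureExact f g :=
  ⟨h, fun X _ _ => ⟨hf X, lTensor_exact X h.exact h.surjective,
    LinearMap.lTensor_surjective X h.surjective⟩⟩

theorem IsPureExact.mem_smul_top (h : IsPureExact f g) {I : Ideal R} {n : N}
    (hn : f n ∈ I • (⊤ : Submodule R M)) : n ∈ I • (⊤ : Submodule R N) := by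
  have mem_iff {P : Type u} [AddCommGroup P] [Module R P] (x : P) :
      (1 : R ⧸ I) ⊗ₜ[R] x = 0 ↔ x ∈ I • (⊤ : Submodule R P) := by
    rw [← map_eq_zero_iff _ (quotTensorEquivQuotSMul P I).injective,
      quotTensorEquivQuotSMul_mk_one_tmul, Submodule.Quotient.mk_eq_zero]
  rw [← mem_iff] at hn ⊢
  exact (h.tensor (R ⧸ I)).injective (by rw [LinearMap.lTensor_tmul, hn, map_zero])

theorem IsPureExact.exists_lift_of_sum_smul_eq_zero (h : IsPureExact f g) {ι : Type*} [Fintype ι]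
    {a : ι → R} {x : ι → L} (hx : ∑ i, a i • x i = 0) :
    ∃ y : ι → M, ∑ i, a i • y i = 0 ∧ ∀ i, g (y i) = x i := by
  choose y hy using fun i => h.shortExact.surjective (x i)
  obtain ⟨n, hn⟩ := (h.shortExact.exact (∑ i, a i • y i)).mp (by simpa [hy] using hx)
  have hmem : n ∈ Ideal.span (Set.range a) • (⊤ : Submodule R N) :=
    h.mem_smul_top (hn ▸ sum_mem fun i _ =>
      Submodule.smul_mem_smul (Ideal.subset_span ⟨i, rfl⟩) trivial)
  obtain ⟨z, rfl⟩ := exists_sum_smul_eq_of_mem_span_smul_top hmem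
  refine ⟨fun i => y i - f (z i), ?_, fun i => ?_⟩
  · simp only [smul_sub, Finset.sum_sub_distrib, ← hn, map_sum, map_smul, sub_self]
  · rw [map_sub, h.shortExact.exact.apply_apply_eq_zero, sub_zero, hy]

theorem isPureInjective_characterModule (X : Type u) [AddCommGroup X] [Module R X] :
    IsPureInjective R (CharacterModule X) :=
  fun _ _ _ _ _ _ _ _ _ _ _ h => h.shortExact.lcomp
    (lTensor_injective_iff_lcomp_characterModule_surjective.mp (h.tensor X).injective)

end PureExact

section Localization

variable {R : Type*} [CommRing R] (S : Submonoid R)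

theorem lTensor_restrictScalars_injective_iff {A N M : Type*} [CommRing A] [Algebra R A]
    [IsLocalization S A] [AddCommGroup N] [Module R N] [Module A N] [IsScalarTower R A N]
    [AddCommGroup M] [Module R M] [Module A M] [IsScalarTower R A M] (f : N →ₗ[A] M) (X : Type*)
    [AddCommGroup X] [Module R X] [Module A X] [IsScalarTower R A X] :
    Function.Injective ((f.restrictScalars R).lTensor X) ↔ Function.Injective (f.lTensor X) := by
  let eN := IsLocalization.moduleTensorEquiv S A X N
  let eM := IsLocalization.moduleTensorEquiv S A X M
  have hcomm : ((f.restrictScalars R).lTensor X) ∘ eN = eM ∘ f.lTensor X := by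
    ext t
    induction t with
    | zero => simp only [map_zero, Function.comp_apply]
    | tmul x n => rfl
    | add t₁ t₂ h₁ h₂ => simp_all only [map_add, Function.comp_apply]
  rw [← EquivLike.injective_comp eN, hcomm, EquivLike.comp_injective]

theorem IsShortExactSeq.localized {N M L : Type*} [AddCommGroup N] [Module R N] [AddCommGroup M]
    [Module R M] [AddCommGroup L] [Module R L] {f : N →ₗ[R] M} {g : M →ₗ[R] L}
    (h : IsShortExactSeq f g) :
    IsShortExactSeq (LocalizedModule.map S f) (LocalizedModule.map S g) :=
  ⟨LocalizedModule.map_injective S f h.injective, LocalizedModule.map_exact S f g h.exact,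
    LocalizedModule.map_surjective S g h.surjective⟩

theorem IsRDExact.localized {N M L : Type*} [AddCommGroup N] [Module R N] [AddCommGroup M]
    [Module R M] [AddCommGroup L] [Module R L] {f : N →ₗ[R] M} {g : M →ₗ[R] L}
    (h : IsRDExact f g) : IsRDExact (LocalizedModule.map S f) (LocalizedModule.map S g) := by
  refine (isRDExact_iff_exists_smul_eq (h.shortExact.localized S)).mpr fun α x y hxy => ?_
  induction α with | H rs
  induction x with | h m t
  induction y with | h n u
  obtain ⟨r, s⟩ := rs
  rw [LocalizedModule.map_mk, LocalizedModule.mk_smul_mk, LocalizedModule.mk_eq] at hxy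
  obtain ⟨v, hv⟩ := hxy
  have hdiv : (v * u * r : R) • m = f ((v * (s * t) : R) • n) := by
    simpa only [map_smul, mul_smul, Submonoid.smul_def, Submonoid.coe_mul] using hv
  obtain ⟨n', hn'⟩ := h.exists_smul_eq hdiv
  refine ⟨LocalizedModule.mk n' t, ?_⟩
  rw [LocalizedModule.mk_smul_mk, LocalizedModule.mk_eq]
  exact ⟨v, by simpa only [mul_smul, Submonoid.smul_def, Submonoid.coe_mul] using hn'⟩

theorem lTensor_injective_of_forall_maximal {N M X : Type*} [AddCommGroup N] [Module R N]
    [AddCommGroup M] [Module R M] [AddCommGroup X] [Module R X] {f : N →ₗ[R] M}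
    (h : ∀ (P : Ideal R) [P.IsMaximal], Function.Injective
      ((LocalizedModule.map P.primeCompl f).lTensor (LocalizedModule P.primeCompl X))) :
    Function.Injective (f.lTensor X) := by
  refine (injective_iff_map_eq_zero _).mpr fun t ht => ?_
  let loc (P : Ideal R) [P.IsMaximal] := TensorProduct.map
    (LocalizedModule.mkLinearMap P.primeCompl X) (LocalizedModule.mkLinearMap P.primeCompl N)
  refine Module.eq_zero_of_localization_maximal _ (fun P _ => loc P) t fun P _ => ?_
  have hinj := (lTensor_restrictScalars_injective_iff P.primeCompl
    (LocalizedModule.map P.primeCompl f) _).mpr (h P)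
  have hcomm : ((LocalizedModule.map P.primeCompl f).restrictScalars R).lTensor
        (LocalizedModule P.primeCompl X) ∘ₗ loc P =
      TensorProduct.map (LocalizedModule.mkLinearMap P.primeCompl X)
        (LocalizedModule.mkLinearMap P.primeCompl M) ∘ₗ f.lTensor X := by
    ext x n
    simp [loc, LocalizedModule.map_mk]
  exact hinj (by rw [← LinearMap.comp_apply, hcomm, LinearMap.comp_apply, ht, map_zero, map_zero])

end Localization

section RDExactImpliesPureExact

/-- Every RD-exact sequence of `R`-modules in the universe of `R` is pure-exact. As a property of
the ring, this is a local condition. -/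
def RDExactImpliesPureExact (R : Type u) [CommRing R] : Prop :=
  ∀ (N M L : Type u) [AddCommGroup N] [Module R N] [AddCommGroup M] [Module R M]
    [AddCommGroup L] [Module R L] (f : N →ₗ[R] M) (g : M →ₗ[R] L),
    IsRDExact f g → IsPureExact f g

theorem RDExactImpliesPureExact.of_forall_maximal {R : Type u} [CommRing R]
    (h : ∀ (P : Ideal R) [P.IsMaximal], RDExactImpliesPureExact (Localization.AtPrime P)) :
    RDExactImpliesPureExact R := fun _ _ _ _ _ _ _ _ _ _ _ hfg =>
  hfg.shortExact.isPureExact fun _ _ _ => lTensor_injective_of_forall_maximal fun P _ =>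
    ((h P _ _ _ _ _ (hfg.localized P.primeCompl)).tensor _).injective

theorem RDExactImpliesPureExact.of_isLocalization {R A : Type u} [CommRing R] [CommRing A]
    [Algebra R A] (S : Submonoid R) [IsLocalization S A] (h : RDExactImpliesPureExact R) :
    RDExactImpliesPureExact A := by
  intro N M L _ _ _ _ _ _ f g hfg
  let _ : Module R N := .compHom N (algebraMap R A)
  let _ : Module R M := .compHom M (algebraMap R A)
  let _ : Module R L := .compHom L (algebraMap R A)
  have : IsScalarTower R A N := .of_algebraMap_smul fun _ _ => rfl
  have : IsScalarTower R A M := .of_algebraMap_smul fun _ _ => rfl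
  have : IsScalarTower R A L := .of_algebraMap_smul fun _ _ => rfl
  refine hfg.shortExact.isPureExact fun X _ _ => ?_
  let _ : Module R X := .compHom X (algebraMap R A)
  have : IsScalarTower R A X := .of_algebraMap_smul fun _ _ => rfl
  have hshort : IsShortExactSeq (f.restrictScalars R) (g.restrictScalars R) :=
    ⟨hfg.shortExact.injective, hfg.shortExact.exact, hfg.shortExact.surjective⟩
  have hRD := (isRDExact_iff_exists_smul_eq hshort).mpr fun r _ _ hmn =>
    hfg.exists_smul_eq (r := algebraMap R A r) hmn
  exact (lTensor_restrictScalars_injective_iff S f X).mp ((h _ _ _ _ _ hRD).tensor X).injective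

theorem IsUniserialRing.rdExactImpliesPureExact {R : Type u} [CommRing R]
    (hR : IsUniserialRing R) : RDExactImpliesPureExact R :=
  fun _ _ _ _ _ _ _ _ _ _ _ h => h.shortExact.isPureExact fun X _ _ => h.lTensor_injective hR X

end RDExactImpliesPureExact

section CyclicCover

variable (R X : Type*) [CommRing R] [AddCommGroup X] [Module R X]

/-- The direct sum of cyclically presented modules `R ⧸ (r)`, with one summand for every linear map
`R ⧸ (r) → X`, so that `X` is a quotient of it by an RD-exact sequence. -/
abbrev CyclicCover : Type _ :=
  Π₀ i : Σ r : R, (R ⧸ Ideal.span {r}) →ₗ[R] X, R ⧸ Ideal.span {i.1}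

open scoped Classical in
/-- The canonical map onto `X`, which on the summand indexed by `ψ : R ⧸ (r) → X` is `ψ`. -/
noncomputable def CyclicCover.proj : CyclicCover R X →ₗ[R] X :=
  DFinsupp.lsum ℕ fun i => i.2

variable {R X}

theorem CyclicCover.exists_lift {r : R} {x : X} (hrx : r • x = 0) :
    ∃ y : CyclicCover R X, r • y = 0 ∧ CyclicCover.proj R X y = x := by
  classical
  let ψ : (R ⧸ Ideal.span {r}) →ₗ[R] X :=
    Submodule.liftQSpanSingleton r (LinearMap.toSpanSingleton R X x) hrx
  refine ⟨DFinsupp.single ⟨r, ψ⟩ 1, ?_, ?_⟩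
  · have hr : r • (1 : R ⧸ Ideal.span {r}) = 0 := by
      rw [Algebra.smul_def, mul_one]
      exact Ideal.Quotient.eq_zero_iff_mem.mpr (Ideal.mem_span_singleton_self r)
    rw [← DFinsupp.single_smul, hr, DFinsupp.single_zero]
  · rw [CyclicCover.proj, DFinsupp.lsum_single]
    exact one_smul R x

theorem CyclicCover.isRDExact :
    IsRDExact (N := LinearMap.ker (CyclicCover.proj R X))
      (LinearMap.ker (CyclicCover.proj R X)).subtype (CyclicCover.proj R X) := by
  have hsurj : Function.Surjective (CyclicCover.proj R X) := fun x =>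
    let ⟨y, _, hy⟩ := CyclicCover.exists_lift (zero_smul R x)
    ⟨y, hy⟩
  exact IsShortExactSeq.isRDExact_of_exists_lift
    ⟨Submodule.injective_subtype _, LinearMap.exact_subtype_ker_map _, hsurj⟩
    fun _ _ => CyclicCover.exists_lift

end CyclicCover

section RelationModule

variable {R : Type*} [CommRing R]

/-- The module with generators `e₁`, `e₂`, the images of `(1, 0)` and `(0, 1)`, and the single
relation `a • e₁ + b • e₂ = 0`. -/
abbrev RelationModule (a b : R) : Type _ := (R × R) ⧸ Submodule.span R {(a, b)}

variable [IsLocalRing R] {a b : R}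

open IsLocalRing

/-- The functional `e₁ ↦ 1`, `e₂ ↦ 0` with values in the residue field, which respects the relation
`a • e₁ + b • e₂ = 0` when `a` lies in the maximal ideal. -/
noncomputable def RelationModule.residueFst (ha : a ∈ maximalIdeal R) :
    RelationModule a b →ₗ[R] ResidueField R :=
  Submodule.liftQSpanSingleton _ (Algebra.linearMap R (ResidueField R) ∘ₗ LinearMap.fst R R R)
    ((residue_eq_zero_iff a).mpr ha)

/- The coefficients come from a map `ψ : R ⧸ (r) → RelationModule a b` with `ψ 1 = (p, q)` and a
solution `(u, v)` of `a x + b y = 0` in `R ⧸ (r)`: then `u * p` is the first coordinate of `ψ u`. -/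
theorem mul_mem_maximalIdeal_of_not_dvd (hab : ¬ a ∣ b) (hba : ¬ b ∣ a) {r c d p q u v : R}
    (hp : r * p = c * a) (hq : r * q = c * b) (hd : a * u + b * v = r * d) :
    u * p ∈ maximalIdeal R := by
  rw [mem_maximalIdeal, mem_nonunits_iff]
  intro hup
  by_cases hc : IsUnit c
  · refine hab ((hc.mul (isUnit_of_mul_isUnit_right hup)).dvd_mul_left.mp ?_)
    exact ⟨q * c, by linear_combination q * hp - p * hq⟩
  · have hunit : IsUnit (u * p - c * d) :=
      (isUnit_or_isUnit_of_isUnit_add (b := c * d) (by rwa [sub_add_cancel])).resolve_right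
        fun h => hc (isUnit_of_mul_isUnit_left h)
    exact hba (hunit.dvd_mul_left.mp ⟨-(p * v), by linear_combination p * hd + d * hp⟩)

theorem RelationModule.residueFst_eq_zero_of_quotient (hab : ¬ a ∣ b) (hba : ¬ b ∣ a)
    (ha : a ∈ maximalIdeal R) {r : R} (ψ : (R ⧸ Ideal.span {r}) →ₗ[R] RelationModule a b)
    {x y : R ⧸ Ideal.span {r}} (hxy : a • x + b • y = 0) :
    RelationModule.residueFst ha (ψ x) = 0 := by
  obtain ⟨u, rfl⟩ := Ideal.Quotient.mk_surjective x
  obtain ⟨v, rfl⟩ := Ideal.Quotient.mk_surjective y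
  obtain ⟨d, hd⟩ := Ideal.mem_span_singleton.mp (Ideal.Quotient.eq_zero_iff_mem.mp hxy)
  obtain ⟨⟨p, q⟩, hpq⟩ := Submodule.Quotient.mk_surjective _ (ψ 1)
  have hψ (s : R) : ψ (Ideal.Quotient.mk _ s) = Submodule.Quotient.mk (s • (p, q)) := by
    rw [Submodule.Quotient.mk_smul, hpq, ← map_smul, Algebra.smul_def, mul_one]
    rfl
  have hr : Ideal.Quotient.mk (Ideal.span {r}) r = 0 :=
    Ideal.Quotient.eq_zero_iff_mem.mpr (Ideal.mem_span_singleton_self r)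
  obtain ⟨c, hc⟩ := Submodule.mem_span_singleton.mp
    ((Submodule.Quotient.mk_eq_zero _).mp ((hψ r).symm.trans (by rw [hr, map_zero])))
  rw [hψ]
  refine (residue_eq_zero_iff _).mpr ?_
  exact mul_mem_maximalIdeal_of_not_dvd hab hba (congrArg Prod.fst hc).symm
    (congrArg Prod.snd hc).symm hd

theorem RelationModule.residueFst_eq_zero_of_dfinsupp {ι : Type*} (hab : ¬ a ∣ b) (hba : ¬ b ∣ a)
    (ha : a ∈ maximalIdeal R) {r : ι → R}
    (ψ : (Π₀ i, R ⧸ Ideal.span {r i}) →ₗ[R] RelationModule a b)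
    {x y : Π₀ i, R ⧸ Ideal.span {r i}} (hxy : a • x + b • y = 0) :
    RelationModule.residueFst ha (ψ x) = 0 := by
  classical
  rw [← DFinsupp.sum_single (f := x), DFinsupp.sum, map_sum, map_sum]
  exact Finset.sum_eq_zero fun i _ => RelationModule.residueFst_eq_zero_of_quotient hab hba ha
    (ψ ∘ₗ DFinsupp.lsingle (R := R) (M := fun i => R ⧸ Ideal.span {r i}) i)
    (DFunLike.congr_fun hxy i)

end RelationModule

theorem RDExactImpliesPureExact.isUniserialRing {R : Type u} [CommRing R] [IsLocalRing R]
    (h : RDExactImpliesPureExact R) : IsUniserialRing R := by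
  refine isUniserialRing_iff_dvd_total.mpr fun a b => ?_
  by_contra! ⟨hab, hba⟩
  have ha : a ∈ IsLocalRing.maximalIdeal R := fun h => hab h.dvd
  let e : Fin 2 → RelationModule a b :=
    ![Submodule.Quotient.mk (1, 0), Submodule.Quotient.mk (0, 1)]
  have he : ∑ i, ![a, b] i • e i = 0 := by
    rw [Fin.sum_univ_two]
    refine (Submodule.Quotient.mk_eq_zero _).mpr (Submodule.mem_span_singleton.mpr ⟨1, ?_⟩)
    simp
  obtain ⟨y, hy, hproj⟩ :=
    (h _ _ _ _ _ (CyclicCover.isRDExact (R := R))).exists_lift_of_sum_smul_eq_zero he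
  rw [Fin.sum_univ_two] at hy
  have hzero := RelationModule.residueFst_eq_zero_of_dfinsupp hab hba ha (CyclicCover.proj R _) hy
  rw [hproj 0] at hzero
  exact one_ne_zero hzero

theorem isArithmeticRing_iff_rdExactImpliesPureExact {R : Type u} [CommRing R] :
    IsArithmeticRing R ↔ RDExactImpliesPureExact R :=
  ⟨fun hR => .of_forall_maximal fun P _ => (hR P).rdExactImpliesPureExact,
    fun h P _ => (h.of_isLocalization P.primeCompl).isUniserialRing⟩

theorem mainTheorem3 (R : Type u) [CommRing R] :
    List.TFAE [
      IsArithmeticRing R,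
      ∀ (N M L : Type u) [AddCommGroup N] [Module R N] [AddCommGroup M] [Module R M]
        [AddCommGroup L] [Module R L] (f : N →ₗ[R] M) (g : M →ₗ[R] L),
        IsRDExact f g → IsPureExact f g,
      ∀ (F : Type u) [AddCommGroup F] [Module R F],
        IsPureInjective R F → IsRDInjective R F] := by
  tfae_have 1 ↔ 2 := isArithmeticRing_iff_rdExactImpliesPureExact
  tfae_have 2 → 3 := fun h F _ _ hF N M L _ _ _ _ _ _ f g hfg => hF N M L f g (h N M L f g hfg)
  tfae_have 3 → 2 := fun h N M L _ _ _ _ _ _ f g hfg => hfg.shortExact.isPureExact fun X _ _ =>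
    lTensor_injective_iff_lcomp_characterModule_surjective.mpr
      (h _ (isPureInjective_characterModule X) N M L f g hfg).surjective
  tfae_finish
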